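/- Let $\mathbb{F}$ be a division ring, $\sigma:\mathbb{F}\to\mathbb{F}$ a ring endomorphism, and $\delta:\mathbb{F}\to\mathbb{F}$ a $\sigma$-derivation, i.e. $\delta$ is additive and $\delta(ab)=\sigma(a)\delta(b)+\delta(a)b$ for all $a,b\in\mathbb{F}$. Let $\mathbb{F}[x;\sigma,\delta]$ be the skew polynomial ring: the left $\mathbb{F}$-vector space with basis $\{x^i : i\ge 0\}$, with the product determined by $x^ix^j=x^{i+j}$ and $xa=\sigma(a)x+\delta(a)$ for $a\in\mathbb{F}$, and with $\deg 0=-\infty$. Call $b$ a conjugate of $a$ if $b=\sigma(\beta)a\beta^{-1}+\delta(\beta)\beta^{-1}$ for some $\beta\in\mathbb{F}\setminus\{0\}$. For $r\ge 1$ and $\mathbf{a}=(a_1,\ldots,a_r)\in\mathbb{F}^r$ put $P_{\mathbf{a}}=(x-a_r)\cdots(x-a_2)(x-a_1)$. For $F\in\mathbb{F}[x;\sigma,\delta]$ write $F=GP_{\mathbf{a}}+R$ with $\deg R<r$ (right Euclidean division; $G$ and $R$ are unique). The Hasse derivative $D_{\mathbf{a}}(F)\in\mathbb{F}$ of order $r$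 is the coefficient of $x^{r-1}$ in $R$. For $a\in\mathbb{F}$ and $i\ge 0$, let $F^{(i)}(a)=D_{(a,\ldots,a)}(F)$, where $(a,\ldots,a)\in\mathbb{F}^{i+1}$. For sequences $\mathbf{a}_i=(a_{i,1},\ldots,a_{i,r_i})\in\mathbb{F}^{r_i}$, $i=1,\ldots,n$, let $V_N(\mathbf{a}_i)$ be the $N\times r_i$ matrix whose entry in row $k$ and column $j$ is $D_{(a_{i,1},\ldots,a_{i,j})}(x^{k-1})$; the confluent Vandermonde matrix of order $N$ is the $N\times\sum_i r_i$ matrix $V_N(\mathbf{a}_1,\ldots,\mathbf{a}_n)=\left(V_N(\mathbf{a}_1),\ldots,V_N(\mathbf{a}_n)\right)$. **Theorem (Hermite interpolation I).** Let $a_1,\ldots,a_n\in\mathbb{F}$ be pairwise non-conjugate and let $r_1,\ldots,r_n$ be positive integers. For all $b_{i,j}\in\mathbb{F}$ ($1\le j\le r_i$, $1\le i\le n$) there exists a unique $F\in\mathbb{F}[x;\sigma,\delta]$ with $\deg(F)<\sum_{i=1}^n r_i$ such that $F^{(j-1)}(a_i)=b_{i,j}$ for all $1\le j\le r_i$ and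 $1\le i\le n$. In particular, if $N=\sum_{i=1}^n r_i$ and $\mathbf{a}_i=(a_i,\ldots,a_i)\in\mathbb{F}^{r_i}$ for $i=1,\ldots,n$, then the $N\times N$ matrix $V_N(\mathbf{a}_1,\ldots,\mathbf{a}_n)$ is invertible over $\mathbb{F}$. -/

import Mathlib

/-- A `σ`-derivation of a ring `F`: an additive map `δ` with `δ (a b) = σ a δ b + δ a b`. -/
structure SkewDerivation {F : Type*} [Ring F] (σ : F →+* F) extends F →+ F where
  leibniz' : ∀ a b : F, toFun (a * b) = σ a * toFun b + toFun a * b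

namespace SkewDerivation

variable {F : Type*} [Ring F] {σ : F →+* F}

instance : CoeFun (SkewDerivation σ) (fun _ => F → F) := ⟨fun δ => δ.toFun⟩

theorem map_add (δ : SkewDerivation σ) (a b : F) : δ (a + b) = δ a + δ b :=
  δ.toAddMonoidHom.map_add a b

theorem map_zero (δ : SkewDerivation σ) : δ 0 = 0 := δ.toAddMonoidHom.map_zero

theorem leibniz (δ : SkewDerivation σ) (a b : F) : δ (a * b) = σ a * δ b + δ a * b :=
  δ.leibniz' a b

theorem map_one (δ : SkewDerivation σ) : δ 1 = 0 := by
  have h := δ.leibniz 1 1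
  simpa using h

end SkewDerivation

/-- `b` is a `(σ, δ)`-conjugate of `a`: `b = σ(β) a β⁻¹ + δ(β) β⁻¹` for some `β ≠ 0`. -/
def IsSkewConjugate {F : Type*} [DivisionRing F] (σ : F →+* F) (δ : SkewDerivation σ)
    (b a : F) : Prop :=
  ∃ β : F, β ≠ 0 ∧ b = σ β * a * β⁻¹ + δ β * β⁻¹

/-- The skew polynomial ring `F[x; σ, δ]`: finitely supported coefficient sequences
`∑ Fᵢ xⁱ` (coefficients on the left); the product below is the one with `x a = σ(a) x + δ(a)`. -/
@[ext]
structure SkewPoly {F : Type*} [DivisionRing F] (σ : F →+* F) (δ : SkewDerivation σ) where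
  /-- The sequence of coefficients. -/
  toFinsupp : ℕ →₀ F

namespace SkewPoly

variable {F : Type*} [DivisionRing F] {σ : F →+* F} {δ : SkewDerivation σ}

/-- On coefficient sequences: `∑ Gᵢ xⁱ ↦ ∑ (σ(Gᵢ) xⁱ⁺¹ + δ(Gᵢ) xⁱ)`, left multiplication by `x`. -/
noncomputable def mulX (σ : F →+* F) (δ : SkewDerivation σ) : (ℕ →₀ F) →+ (ℕ →₀ F) :=
  Finsupp.liftAddHom fun i =>
    (Finsupp.singleAddHom (i + 1)).comp σ.toAddMonoidHom +
      (Finsupp.singleAddHom i).comp δ.toAddMonoidHom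

/-- On coefficient sequences: left multiplication by `xⁱ`. -/
noncomputable def mulXPow (σ : F →+* F) (δ : SkewDerivation σ) : ℕ → (ℕ →₀ F) →+ (ℕ →₀ F)
  | 0 => AddMonoidHom.id _
  | i + 1 => (mulX σ δ).comp (mulXPow σ δ i)

/-- On coefficient sequences: `mulLeft F G = ∑ Fᵢ (xⁱ G)`, the product of `∑ Fᵢ xⁱ` and `G`. -/
noncomputable def mulLeft (σ : F →+* F) (δ : SkewDerivation σ) :
    (ℕ →₀ F) →+ (ℕ →₀ F) →+ (ℕ →₀ F) :=
  Finsupp.liftAddHom fun i =>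
    { toFun := fun c => (DistribSMul.toAddMonoidHom (ℕ →₀ F) c).comp (mulXPow σ δ i)
      map_zero' := AddMonoidHom.ext fun G => zero_smul F (mulXPow σ δ i G)
      map_add' := fun c d => AddMonoidHom.ext fun G => add_smul c d (mulXPow σ δ i G) }

theorem mulXPow_succ (i : ℕ) (G : ℕ →₀ F) :
    mulXPow σ δ (i + 1) G = mulX σ δ (mulXPow σ δ i G) := rfl

theorem mulXPow_zero (G : ℕ →₀ F) : mulXPow σ δ 0 G = G := rfl

theorem mulX_single (i : ℕ) (c : F) :
    mulX σ δ (Finsupp.single i c) = Finsupp.single (i + 1) (σ c) + Finsupp.single i (δ c) := by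
  simp [mulX]

theorem mulLeft_single (i : ℕ) (c : F) (G : ℕ →₀ F) :
    mulLeft σ δ (Finsupp.single i c) G = c • mulXPow σ δ i G := by
  simp [mulLeft]

theorem mulX_smul (c : F) (G : ℕ →₀ F) :
    mulX σ δ (c • G) = σ c • mulX σ δ G + δ c • G := by
  induction G using Finsupp.induction_linear with
  | zero => simp
  | add f g hf hg => simp only [smul_add, _root_.map_add, hf, hg]; abel
  | single i d =>
    simp only [Finsupp.smul_single, smul_eq_mul, mulX_single, map_mul, δ.leibniz,
      Finsupp.single_add, smul_add]
    abel

theorem mulLeft_mulX (f G : ℕ →₀ F) :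
    mulLeft σ δ (mulX σ δ f) G = mulX σ δ (mulLeft σ δ f G) := by
  induction f using Finsupp.induction_linear with
  | zero => simp
  | add f g hf hg => simp only [_root_.map_add, AddMonoidHom.add_apply, hf, hg]
  | single i d =>
    rw [mulX_single, _root_.map_add, AddMonoidHom.add_apply, mulLeft_single, mulLeft_single,
      mulLeft_single, mulX_smul, mulXPow_succ]

theorem mulLeft_smul (c : F) (f G : ℕ →₀ F) :
    mulLeft σ δ (c • f) G = c • mulLeft σ δ f G := by
  induction f using Finsupp.induction_linear with
  | zero => simp
  | add f g hf hg => simp only [smul_add, _root_.map_add, AddMonoidHom.add_apply, hf, hg]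
  | single i d =>
    rw [Finsupp.smul_single, smul_eq_mul, mulLeft_single, mulLeft_single, mul_smul]

theorem mulLeft_mulX_pow (i : ℕ) (f G : ℕ →₀ F) :
    mulLeft σ δ (mulXPow σ δ i f) G =
      mulXPow σ δ i (mulLeft σ δ f G) := by
  induction i with
  | zero => rfl
  | succ i ih =>
    rw [mulXPow_succ, mulXPow_succ, mulLeft_mulX, ih]

theorem mulLeft_mulLeft (f g G : ℕ →₀ F) :
    mulLeft σ δ (mulLeft σ δ f g) G = mulLeft σ δ f (mulLeft σ δ g G) := by
  induction f using Finsupp.induction_linear with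
  | zero => simp
  | add f g hf hg => simp only [_root_.map_add, AddMonoidHom.add_apply, hf, hg]
  | single i d => rw [mulLeft_single, mulLeft_single, mulLeft_smul, mulLeft_mulX_pow]

theorem mulX_pow_single_one (i : ℕ) :
    mulXPow σ δ i (Finsupp.single 0 1) = Finsupp.single i (1 : F) := by
  induction i with
  | zero => rfl
  | succ i ih =>
    rw [mulXPow_succ, ih, mulX_single, _root_.map_one, δ.map_one]
    simp

theorem mulLeft_one (f : ℕ →₀ F) : mulLeft σ δ f (Finsupp.single 0 1) = f := by
  induction f using Finsupp.induction_linear with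
  | zero => simp
  | add f g hf hg => simp only [_root_.map_add, AddMonoidHom.add_apply, hf, hg]
  | single i d => simp [mulLeft_single, mulX_pow_single_one]

noncomputable instance : Zero (SkewPoly σ δ) := ⟨⟨0⟩⟩
noncomputable instance : One (SkewPoly σ δ) := ⟨⟨Finsupp.single 0 1⟩⟩
noncomputable instance : Add (SkewPoly σ δ) := ⟨fun f g => ⟨f.toFinsupp + g.toFinsupp⟩⟩
noncomputable instance : Neg (SkewPoly σ δ) := ⟨fun f => ⟨-f.toFinsupp⟩⟩
noncomputable instance : Mul (SkewPoly σ δ) :=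
  ⟨fun f g => ⟨mulLeft σ δ f.toFinsupp g.toFinsupp⟩⟩

theorem toFinsupp_zero : (0 : SkewPoly σ δ).toFinsupp = 0 := rfl
theorem toFinsupp_one : (1 : SkewPoly σ δ).toFinsupp = Finsupp.single 0 1 := rfl
theorem toFinsupp_add (f g : SkewPoly σ δ) :
    (f + g).toFinsupp = f.toFinsupp + g.toFinsupp := rfl
theorem toFinsupp_neg (f : SkewPoly σ δ) : (-f).toFinsupp = -f.toFinsupp := rfl
theorem toFinsupp_mul (f g : SkewPoly σ δ) :
    (f * g).toFinsupp = mulLeft σ δ f.toFinsupp g.toFinsupp := rfl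

noncomputable instance : Ring (SkewPoly σ δ) where
  add_assoc f g h := SkewPoly.ext (add_assoc _ _ _)
  zero_add f := SkewPoly.ext (zero_add _)
  add_zero f := SkewPoly.ext (add_zero _)
  add_comm f g := SkewPoly.ext (add_comm _ _)
  neg_add_cancel f := SkewPoly.ext (neg_add_cancel _)
  nsmul := nsmulRec
  zsmul := zsmulRec
  left_distrib f g h := SkewPoly.ext (by simp [toFinsupp_mul, toFinsupp_add])
  right_distrib f g h := SkewPoly.ext (by simp [toFinsupp_mul, toFinsupp_add])
  zero_mul f := SkewPoly.ext (by simp [toFinsupp_mul, toFinsupp_zero])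
  mul_zero f := SkewPoly.ext (by simp [toFinsupp_mul, toFinsupp_zero])
  mul_assoc f g h := SkewPoly.ext (mulLeft_mulLeft _ _ _)
  one_mul f := SkewPoly.ext (by simp [toFinsupp_mul, toFinsupp_one, mulLeft_single, mulXPow_zero])
  mul_one f := SkewPoly.ext (mulLeft_one _)

/-- The constant skew polynomial `c`. -/
noncomputable def C (c : F) : SkewPoly σ δ := ⟨Finsupp.single 0 c⟩

/-- The variable `x`. -/
noncomputable def X : SkewPoly σ δ := ⟨Finsupp.single 1 1⟩

/-- The coefficient of `xⁱ` (written on the left of `xⁱ`). -/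
def coeff (f : SkewPoly σ δ) (i : ℕ) : F := f.toFinsupp i

/-- The degree, with `deg 0 = -∞`. -/
def degree (f : SkewPoly σ δ) : WithBot ℕ := f.toFinsupp.support.max

/-- The defining relation `x c = σ(c) x + δ(c)`. -/
theorem X_mul_C (c : F) : (X * C c : SkewPoly σ δ) = C (σ c) * X + C (δ c) := by
  apply SkewPoly.ext
  rw [toFinsupp_add, toFinsupp_mul, toFinsupp_mul]
  simp [X, C, mulLeft_single, mulXPow_succ, mulXPow_zero, mulX_single]

/-- `c xⁱ` is the sequence with `c` in position `i` and `0` elsewhere. -/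
theorem C_mul_X_pow (c : F) (i : ℕ) : (C c * X ^ i : SkewPoly σ δ) = ⟨Finsupp.single i c⟩ := by
  have hX : ∀ i : ℕ, (X ^ i : SkewPoly σ δ) = ⟨Finsupp.single i 1⟩ := by
    intro i
    induction i with
    | zero => rfl
    | succ i ih =>
      rw [pow_succ', ih]
      apply SkewPoly.ext
      rw [toFinsupp_mul]
      simp [X, mulLeft_single, mulXPow_succ, mulXPow_zero, mulX_single, δ.map_one]
  rw [hX]
  apply SkewPoly.ext
  rw [toFinsupp_mul]
  simp [C, mulLeft_single, mulXPow_zero]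

theorem coeff_add (f g : SkewPoly σ δ) (i : ℕ) : (f + g).coeff i = f.coeff i + g.coeff i := by
  simp [coeff, toFinsupp_add]

theorem coeff_sub (f g : SkewPoly σ δ) (i : ℕ) : (f - g).coeff i = f.coeff i - g.coeff i := by
  rw [sub_eq_add_neg, coeff_add, sub_eq_add_neg]
  simp [coeff, toFinsupp_neg]

theorem degree_lt_iff (f : SkewPoly σ δ) (N : ℕ) :
    f.degree < (N : WithBot ℕ) ↔ ∀ i, N ≤ i → f.coeff i = 0 := by
  have hsup : f.degree < ((N : ℕ) : WithBot ℕ) ↔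
      ∀ i ∈ f.toFinsupp.support, ((i : ℕ) : WithBot ℕ) < ((N : ℕ) : WithBot ℕ) :=
    Finset.sup_lt_iff (WithBot.bot_lt_coe N)
  rw [hsup]
  constructor
  · intro h i hi
    by_contra hne
    have := h i (Finsupp.mem_support_iff.2 hne)
    exact absurd (Nat.cast_lt.1 this) (not_lt.2 hi)
  · intro h i hi
    by_contra hlt
    exact Finsupp.mem_support_iff.1 hi (h i (by exact_mod_cast not_lt.1 hlt))

/-- `f` is monic of degree `r`. -/
def IsMonicOfDegree (f : SkewPoly σ δ) (r : ℕ) : Prop :=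
  f.coeff r = 1 ∧ ∀ i, r < i → f.coeff i = 0

theorem coeff_mulX (G : ℕ →₀ F) (i : ℕ) :
    mulX σ δ G (i + 1) = σ (G i) + δ (G (i + 1)) := by
  induction G using Finsupp.induction_linear with
  | zero => simp [δ.map_zero]
  | add f g hf hg =>
    simp only [_root_.map_add, Finsupp.add_apply, hf, hg, δ.map_add]; abel
  | single j d =>
    rw [mulX_single]
    simp only [Finsupp.add_apply, Finsupp.single_apply, add_left_inj]
    split_ifs <;> simp [δ.map_zero]

theorem mulX_pow_monic (P : ℕ →₀ F) (r : ℕ) (h1 : P r = 1) (h2 : ∀ i, r < i → P i = 0) (m : ℕ) :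
    mulXPow σ δ m P (m + r) = 1 ∧
      ∀ i, m + r < i → mulXPow σ δ m P i = 0 := by
  induction m with
  | zero => simpa using ⟨h1, h2⟩
  | succ m ih =>
    have key : ∀ i, mulXPow σ δ (m + 1) P (i + 1) =
        σ (mulXPow σ δ m P i) +
          δ (mulXPow σ δ m P (i + 1)) := fun i => coeff_mulX _ i
    constructor
    · rw [show m + 1 + r = (m + r) + 1 by omega, key, ih.1, ih.2 _ (by omega)]
      simp [δ.map_zero]
    · intro i hi
      obtain ⟨k, rfl⟩ : ∃ k, i = k + 1 := ⟨i - 1, by omega⟩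
      rw [key, ih.2 _ (by omega), ih.2 _ (by omega)]
      simp [δ.map_zero]

theorem coeff_monomial_mul (P : SkewPoly σ δ) {r : ℕ} (hP : P.IsMonicOfDegree r) (c : F) (m : ℕ) :
    ((⟨Finsupp.single m c⟩ : SkewPoly σ δ) * P).coeff (m + r) = c ∧
      ∀ i, m + r < i → ((⟨Finsupp.single m c⟩ : SkewPoly σ δ) * P).coeff i = 0 := by
  have h := mulX_pow_monic (σ := σ) (δ := δ) P.toFinsupp r hP.1 hP.2 m
  constructor
  · simp [coeff, toFinsupp_mul, mulLeft_single, h.1]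
  · intro i hi
    simp [coeff, toFinsupp_mul, mulLeft_single, h.2 i hi]

/-- Right division by a monic skew polynomial `P` of degree `r`: existence of the remainder. -/
theorem exists_remainder (P : SkewPoly σ δ) {r : ℕ} (hP : P.IsMonicOfDegree r) (f : SkewPoly σ δ) :
    ∃ R : SkewPoly σ δ, R.degree < (r : WithBot ℕ) ∧ ∃ G, f = G * P + R := by
  have main : ∀ (m : ℕ) (f : SkewPoly σ δ), f.degree < ((m + r : ℕ) : WithBot ℕ) →
      ∃ R : SkewPoly σ δ, R.degree < (r : WithBot ℕ) ∧ ∃ G, f = G * P + R := by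
    intro m
    induction m with
    | zero => intro f hf; exact ⟨f, by simpa using hf, 0, by simp⟩
    | succ m ih =>
      intro f hf
      set M : SkewPoly σ δ := ⟨Finsupp.single m (f.coeff (m + r))⟩ with hM
      have hc := coeff_monomial_mul P hP (f.coeff (m + r)) m
      obtain ⟨R, hR, G, hG⟩ := ih (f - M * P) (by
        rw [degree_lt_iff] at hf ⊢
        intro i hi
        rw [coeff_sub]
        rcases hi.eq_or_lt with rfl | hlt
        · rw [hc.1, sub_self]
        · rw [hc.2 i hlt, hf i (by omega), sub_self])
      exact ⟨R, hR, G + M, by rw [add_mul, add_right_comm, ← hG, sub_add_cancel]⟩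
  obtain ⟨B, hB⟩ : ∃ B : ℕ, ∀ i, B ≤ i → f.coeff i = 0 := by
    refine ⟨f.toFinsupp.support.sup id + 1, fun i hi => ?_⟩
    by_contra hne
    have := Finset.le_sup (f := id) (Finsupp.mem_support_iff.2 hne)
    simp only [id] at this
    omega
  exact main B f ((degree_lt_iff _ _).2 fun i hi => hB i (by omega))

/-- Right division by a monic skew polynomial `P` of degree `r`: the remainder is unique. -/
theorem existsUnique_remainder (P : SkewPoly σ δ) {r : ℕ} (hP : P.IsMonicOfDegree r)
    (f : SkewPoly σ δ) :
    ∃! R : SkewPoly σ δ, R.degree < (r : WithBot ℕ) ∧ ∃ G, f = G * P + R := by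
  obtain ⟨R, hR, G, hG⟩ := exists_remainder P hP f
  refine ⟨R, ⟨hR, G, hG⟩, ?_⟩
  rintro R' ⟨hR', G', hG'⟩
  have hE : (G - G') * P = R' - R := by
    rw [sub_mul, sub_eq_sub_iff_add_eq_add, ← hG, add_comm R', ← hG']
  have hlow : ∀ i, r ≤ i → ((G - G') * P).coeff i = 0 := by
    intro i hi
    rw [hE, coeff_sub, (degree_lt_iff _ _).1 hR' i hi, (degree_lt_iff _ _).1 hR i hi, sub_self]
  have hzero : G - G' = 0 := by
    have main : ∀ (m : ℕ) (Q : SkewPoly σ δ), (∀ i, m ≤ i → Q.coeff i = 0) →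
        (∀ i, r ≤ i → (Q * P).coeff i = 0) → Q = 0 := by
      intro m
      induction m with
      | zero =>
        intro Q hQ _
        exact SkewPoly.ext (Finsupp.ext fun i => hQ i (Nat.zero_le _))
      | succ m ih =>
        intro Q hQ hQP
        apply ih Q _ hQP
        intro i hi
        rcases hi.eq_or_lt with rfl | hlt
        · have hs : (Q * P).coeff (m + r) = Q.coeff m := by
            have hsum : (Q * P).coeff (m + r) = ∑ k ∈ Q.toFinsupp.support,
                ((⟨Finsupp.single k (Q.coeff k)⟩ : SkewPoly σ δ) * P).coeff (m + r) := by
              simp only [coeff, toFinsupp_mul]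
              conv_lhs => rw [← Finsupp.sum_single Q.toFinsupp, Finsupp.sum]
              simp [map_sum, AddMonoidHom.finsetSum_apply, Finsupp.finsetSum_apply]
            rw [hsum, Finset.sum_eq_single m]
            · exact (coeff_monomial_mul P hP _ m).1
            · intro k hk hkm
              have hkm' : k < m := by
                by_contra hge
                exact Finsupp.mem_support_iff.1 hk (hQ k (by omega))
              exact (coeff_monomial_mul P hP _ k).2 _ (by omega)
            · intro hm
              have h0 : Q.coeff m = 0 := Finsupp.notMem_support_iff.1 hm
              rw [(coeff_monomial_mul P hP _ m).1, h0]
          rw [← hs]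
          exact hQP _ (by omega)
        · exact hQ i hlt
    refine main ((G - G').toFinsupp.support.sup id + 1) _ (fun i hi => ?_) hlow
    by_contra hne
    have := Finset.le_sup (f := id) (Finsupp.mem_support_iff.2 hne)
    simp only [id] at this
    omega
  rw [hzero, zero_mul] at hE
  exact sub_eq_zero.1 hE.symm

/-- The product `P_𝐚 = (x - aᵣ) ⋯ (x - a₂) (x - a₁)` of a sequence `𝐚 = (a₁, …, aᵣ)`. -/
noncomputable def linProd (σ : F →+* F) (δ : SkewDerivation σ) :
    {r : ℕ} → (Fin r → F) → SkewPoly σ δ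
  | 0, _ => 1
  | r + 1, a => (X - C (a (Fin.last r))) * linProd σ δ fun i : Fin r => a i.castSucc

theorem linProd_isMonicOfDegree {r : ℕ} (a : Fin r → F) :
    (linProd σ δ a).IsMonicOfDegree r := by
  induction r with
  | zero =>
    exact ⟨Finsupp.single_eq_same, fun i hi => Finsupp.single_eq_of_ne hi.ne'⟩
  | succ r ih =>
    have ih' := ih fun i : Fin r => a i.castSucc
    have h1 := coeff_monomial_mul _ ih' 1 1
    have h0 := coeff_monomial_mul _ ih' (a (Fin.last r)) 0
    rw [linProd, sub_mul]
    constructor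
    · rw [coeff_sub, add_comm]
      exact (congrArg₂ (· - ·) h1.1 (h0.2 _ (by omega))).trans (sub_zero 1)
    · intro i hi
      rw [coeff_sub]
      exact (congrArg₂ (· - ·) (h1.2 i (by omega)) (h0.2 i (by omega))).trans (sub_zero 0)

/-- The remainder of `f` under right division by `P_𝐚`: the unique `R` of degree `< r` such that
`f = G P_𝐚 + R` for some `G`. -/
noncomputable def remainder {r : ℕ} (a : Fin r → F) (f : SkewPoly σ δ) : SkewPoly σ δ :=
  (existsUnique_remainder (linProd σ δ a) (linProd_isMonicOfDegree a) f).choose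

theorem remainder_spec {r : ℕ} (a : Fin r → F) (f : SkewPoly σ δ) :
    (remainder a f).degree < (r : WithBot ℕ) ∧ ∃ G, f = G * linProd σ δ a + remainder a f :=
  (existsUnique_remainder (linProd σ δ a) (linProd_isMonicOfDegree a) f).choose_spec.1

/-- The Hasse derivative `D_𝐚(f)` of order `r + 1` at `𝐚 = (a₁, …, aᵣ₊₁)`: the coefficient of `xʳ`
in the remainder of `f` under right division by `P_𝐚`. -/
noncomputable def hasseDeriv {r : ℕ} (a : Fin (r + 1) → F) (f : SkewPoly σ δ) : F :=
  (remainder a f).coeff r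

/-- `f^{(i)}(a)`: the Hasse derivative of `f` at the constant sequence `(a, …, a)` of
length `i + 1`. -/
noncomputable def hasseDerivAt (f : SkewPoly σ δ) (i : ℕ) (a : F) : F :=
  hasseDeriv (fun _ : Fin (i + 1) => a) f

end SkewPoly

/-- The confluent Vandermonde matrix `V_N(𝐚)` on one sequence `𝐚 = (a₁, …, aᵣ)`: the entry in
row `k` (from `0`) and column `j` (from `0`) is `D_{(a₁, …, aⱼ₊₁)}(xᵏ)`. -/
noncomputable def confluentVandermondeBlock {F : Type*} [DivisionRing F] (σ : F →+* F)
    (δ : SkewDerivation σ) (N : ℕ) {r : ℕ} (a : Fin r → F) : Matrix (Fin N) (Fin r) F :=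
  Matrix.of fun k j =>
    SkewPoly.hasseDeriv (fun l : Fin ((j : ℕ) + 1) => a (Fin.castLE j.isLt l))
      (SkewPoly.X ^ (k : ℕ) : SkewPoly σ δ)

/-- The confluent Vandermonde matrix `V_N(𝐚₁, …, 𝐚ₙ) = (V_N(𝐚₁), …, V_N(𝐚ₙ))`, with its blocks
placed side by side in this order (`finSigmaFinEquiv` numbers the pairs `(i, j)`
lexicographically). -/
noncomputable def confluentVandermonde {F : Type*} [DivisionRing F] (σ : F →+* F)
    (δ : SkewDerivation σ) (N : ℕ) {n : ℕ} (r : Fin n → ℕ) (a : (i : Fin n) → Fin (r i) → F) :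
    Matrix (Fin N) (Fin (∑ i, r i)) F :=
  Matrix.of fun k c =>
    confluentVandermondeBlock σ δ N (a (finSigmaFinEquiv.symm c).1) k (finSigmaFinEquiv.symm c).2

/-! Put N = ∑ rᵢ. Sending F to all the values F^{(j-1)}(aᵢ) is a left-linear map from the
polynomials of degree < N to 𝔽^N. In the basis 1, x, …, x^{N-1} it is v ↦ vV, with V the confluent
Vandermonde matrix. Both sides have dimension N, so existence, uniqueness and invertibility of V all
follow from injectivity.

If all the values vanish, F is right divisible by every (x - aᵢ)^{rᵢ} (`exists_eq_mul_X_sub_C_pow`).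
It remains to see that such an F is a left multiple of a monic polynomial of degree N, for then deg
F < N forces F = 0. This is `exists_list_of_common_left_multiple`: split off one factor x - b on the
right and show that the quotient is still divisible by the other products, up to conjugation of
their roots. The tool is the exchange (x - a')(x - b) = (x - b')(x - a) for a ≠ b, with a' conjugate
to a and b' to b. Since roots only move inside their conjugacy classes, non-conjugacy survives and
the argument can be iterated. -/

namespace IsSkewConjugate

variable {F : Type*} [DivisionRing F] {σ : F →+* F} {δ : SkewDerivation σ}

/-! ### Conjugacy is an equivalence relation. -/

theorem iff_exists_mul {a b : F} :
    IsSkewConjugate σ δ b a ↔ ∃ β : F, β ≠ 0 ∧ b * β = σ β * a + δ β := by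
  refine exists_congr fun β => and_congr_right fun hβ => ?_
  rw [← add_mul, eq_mul_inv_iff_mul_eq₀ hβ]

theorem refl (a : F) : IsSkewConjugate σ δ a a :=
  iff_exists_mul.2 ⟨1, one_ne_zero, by simp [δ.map_one]⟩

theorem symm {a b : F} (h : IsSkewConjugate σ δ b a) : IsSkewConjugate σ δ a b := by
  obtain ⟨β, hβ, h⟩ := iff_exists_mul.1 h
  refine iff_exists_mul.2 ⟨β⁻¹, inv_ne_zero hβ, ?_⟩
  have hσ : σ β ≠ 0 := (map_ne_zero σ).2 hβ
  -- The Leibniz rule applied to β β⁻¹ = 1 determines δ(β⁻¹).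
  have h1 : σ β * δ β⁻¹ + δ β * β⁻¹ = 0 := by
    rw [← δ.leibniz, mul_inv_cancel₀ hβ, δ.map_one]
  apply mul_left_cancel₀ hσ
  rw [mul_add, ← mul_assoc (σ β) (σ β⁻¹), ← map_mul, mul_inv_cancel₀ hβ, map_one, one_mul,
    eq_neg_of_add_eq_zero_left h1, ← mul_assoc, eq_sub_of_add_eq h.symm, sub_mul,
    mul_inv_cancel_right₀ hβ, sub_eq_add_neg]

theorem trans {a b c : F} (h : IsSkewConjugate σ δ c b) (h' : IsSkewConjugate σ δ b a) :
    IsSkewConjugate σ δ c a := by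
  obtain ⟨β, hβ, h⟩ := iff_exists_mul.1 h
  obtain ⟨γ, hγ, h'⟩ := iff_exists_mul.1 h'
  refine iff_exists_mul.2 ⟨β * γ, mul_ne_zero hβ hγ, ?_⟩
  rw [← mul_assoc, h, add_mul, mul_assoc, h', map_mul, δ.leibniz, mul_add, mul_assoc, add_assoc]

end IsSkewConjugate

namespace SkewPoly

variable {F : Type*} [DivisionRing F] {σ : F →+* F} {δ : SkewDerivation σ}

/-! ### Coefficients, degrees and monic right factors. -/

theorem C_add (a b : F) : (C (a + b) : SkewPoly σ δ) = C a + C b :=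
  SkewPoly.ext (Finsupp.single_add ..)

theorem C_zero : (C 0 : SkewPoly σ δ) = 0 :=
  SkewPoly.ext (Finsupp.single_zero _)

theorem C_sub (a b : F) : (C (a - b) : SkewPoly σ δ) = C a - C b := by
  rw [eq_sub_iff_add_eq, ← C_add, sub_add_cancel]

theorem C_mul (a b : F) : (C (a * b) : SkewPoly σ δ) = C a * C b := by
  apply SkewPoly.ext
  rw [toFinsupp_mul]
  simp [C, mulLeft_single, mulXPow_zero]

theorem coeff_C (c : F) (i : ℕ) : (C c : SkewPoly σ δ).coeff i = if i = 0 then c else 0 := by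
  simp [C, coeff, Finsupp.single_apply, eq_comm]

theorem coeff_zero (i : ℕ) : (0 : SkewPoly σ δ).coeff i = 0 := rfl

theorem coeff_C_mul (c : F) (f : SkewPoly σ δ) (i : ℕ) : (C c * f).coeff i = c * f.coeff i := by
  simp [coeff, toFinsupp_mul, C, mulLeft_single, mulXPow_zero]

theorem coeff_sum {ι : Type*} (s : Finset ι) (f : ι → SkewPoly σ δ) (i : ℕ) :
    (∑ k ∈ s, f k).coeff i = ∑ k ∈ s, (f k).coeff i :=
  map_sum (AddMonoidHom.mk' (fun g : SkewPoly σ δ => g.coeff i) fun _ _ => coeff_add _ _ _) f s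

theorem coeff_C_mul_X_pow (c : F) (k i : ℕ) :
    (C c * X ^ k : SkewPoly σ δ).coeff i = if k = i then c else 0 := by
  rw [C_mul_X_pow]
  simp [coeff, Finsupp.single_apply]

theorem degree_zero_lt (N : ℕ) : (0 : SkewPoly σ δ).degree < (N : WithBot ℕ) :=
  (degree_lt_iff _ _).2 fun _ _ => rfl

theorem degree_add_lt {f g : SkewPoly σ δ} {N : ℕ} (hf : f.degree < (N : WithBot ℕ))
    (hg : g.degree < (N : WithBot ℕ)) : (f + g).degree < (N : WithBot ℕ) := by
  rw [degree_lt_iff] at *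
  intro i hi
  rw [coeff_add, hf i hi, hg i hi, add_zero]

theorem degree_sub_lt {f g : SkewPoly σ δ} {N : ℕ} (hf : f.degree < (N : WithBot ℕ))
    (hg : g.degree < (N : WithBot ℕ)) : (f - g).degree < (N : WithBot ℕ) := by
  rw [degree_lt_iff] at *
  intro i hi
  rw [coeff_sub, hf i hi, hg i hi, sub_zero]

theorem degree_C_mul_lt (c : F) {f : SkewPoly σ δ} {N : ℕ} (hf : f.degree < (N : WithBot ℕ)) :
    (C c * f).degree < (N : WithBot ℕ) := by
  rw [degree_lt_iff] at *
  intro i hi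
  rw [coeff_C_mul, hf i hi, mul_zero]

/-- Both f and 0 are remainders of f modulo P, and remainders are unique. -/
theorem IsMonicOfDegree.eq_zero_of_degree_lt {P : SkewPoly σ δ} {r : ℕ}
    (hP : P.IsMonicOfDegree r) {f g : SkewPoly σ δ} (hf : f.degree < (r : WithBot ℕ))
    (h : f = g * P) : f = 0 :=
  (existsUnique_remainder P hP f).unique ⟨hf, 0, by simp⟩ ⟨degree_zero_lt r, g, by simpa using h⟩

theorem IsMonicOfDegree.X_sub_C_mul {P : SkewPoly σ δ} {r : ℕ} (hP : P.IsMonicOfDegree r) (b : F) :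
    ((X - C b) * P).IsMonicOfDegree (r + 1) := by
  have h1 := coeff_monomial_mul _ hP 1 1
  have h0 := coeff_monomial_mul _ hP b 0
  rw [sub_mul]
  constructor
  · rw [coeff_sub, add_comm]
    exact (congrArg₂ (· - ·) h1.1 (h0.2 _ (by omega))).trans (sub_zero 1)
  · intro i hi
    rw [coeff_sub]
    exact (congrArg₂ (· - ·) (h1.2 i (by omega)) (h0.2 i (by omega))).trans (sub_zero 0)

theorem one_isMonicOfDegree : (1 : SkewPoly σ δ).IsMonicOfDegree 0 :=
  ⟨Finsupp.single_eq_same, fun _ hi => Finsupp.single_eq_of_ne hi.ne'⟩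

theorem X_sub_C_isMonicOfDegree (b : F) : (X - C b : SkewPoly σ δ).IsMonicOfDegree 1 := by
  simpa using one_isMonicOfDegree.X_sub_C_mul b

theorem eq_sum_of_degree_lt {f : SkewPoly σ δ} {N : ℕ} (hf : f.degree < (N : WithBot ℕ)) :
    f = ∑ k ∈ Finset.range N, C (f.coeff k) * X ^ k := by
  refine SkewPoly.ext (Finsupp.ext fun i => ?_)
  change f.coeff i = (∑ k ∈ Finset.range N, C (f.coeff k) * X ^ k : SkewPoly σ δ).coeff i
  simp only [coeff_sum, coeff_C_mul_X_pow, Finset.sum_ite_eq', Finset.mem_range]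
  split_ifs with h
  · rfl
  · exact (degree_lt_iff _ _).1 hf i (not_lt.1 h)

theorem exists_degree_lt (f : SkewPoly σ δ) : ∃ N : ℕ, f.degree < (N : WithBot ℕ) := by
  refine ⟨f.toFinsupp.support.sup id + 1, (degree_lt_iff _ _).2 fun i hi => ?_⟩
  by_contra hne
  have := Finset.le_sup (f := id) (Finsupp.mem_support_iff.2 hne)
  simp only [id] at this
  omega

/-- Each xᵏP is monic of degree k + r because σ(1) = 1 and δ(1) = 0, so only the term k = N reaches
degree N + r. -/
theorem IsMonicOfDegree.coeff_mul_add {P : SkewPoly σ δ} {r : ℕ} (hP : P.IsMonicOfDegree r)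
    {f : SkewPoly σ δ} {N : ℕ} (hf : f.degree < ((N + 1 : ℕ) : WithBot ℕ)) :
    (f * P).coeff (N + r) = f.coeff N := by
  conv_lhs => rw [eq_sum_of_degree_lt hf]
  rw [Finset.sum_mul, coeff_sum, Finset.sum_range_succ, C_mul_X_pow,
    (coeff_monomial_mul P hP _ N).1, Finset.sum_eq_zero, zero_add]
  intro k hk
  rw [C_mul_X_pow]
  exact (coeff_monomial_mul P hP _ k).2 _ (by have := Finset.mem_range.1 hk; omega)

theorem IsMonicOfDegree.eq_zero_of_mul_eq_zero {P : SkewPoly σ δ} {r : ℕ}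
    (hP : P.IsMonicOfDegree r) {f : SkewPoly σ δ} (h : f * P = 0) : f = 0 := by
  obtain ⟨N, hN⟩ := exists_degree_lt f
  induction N with
  | zero => simpa using eq_sum_of_degree_lt hN
  | succ N ih =>
    refine ih ((degree_lt_iff _ _).2 fun i hi => ?_)
    rcases hi.eq_or_lt with rfl | hi
    · rw [← hP.coeff_mul_add hN, h, coeff_zero]
    · exact (degree_lt_iff _ _).1 hN i hi

theorem mul_X_sub_C_cancel (b : F) {f g : SkewPoly σ δ} (h : f * (X - C b) = g * (X - C b)) :
    f = g :=
  sub_eq_zero.1 <| (X_sub_C_isMonicOfDegree b).eq_zero_of_mul_eq_zero (by rw [sub_mul, h, sub_self])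

/-! ### Products of linear factors and common left multiples. -/

/-- The product `(x - bₘ) ⋯ (x - b₁)` of a list `[b₁, …, bₘ]`. -/
noncomputable def listProd (σ : F →+* F) (δ : SkewDerivation σ) (L : List F) : SkewPoly σ δ :=
  (L.reverse.map fun b => X - C b).prod

theorem listProd_nil : listProd σ δ [] = 1 := rfl

theorem listProd_cons (b : F) (L : List F) :
    listProd σ δ (b :: L) = listProd σ δ L * (X - C b) := by
  simp [listProd]

theorem listProd_isMonicOfDegree (L : List F) : (listProd σ δ L).IsMonicOfDegree L.length := by
  induction L using List.reverseRecOn with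
  | nil => exact one_isMonicOfDegree
  | append_singleton L b ih => simpa [listProd] using ih.X_sub_C_mul b

theorem listProd_replicate (r : ℕ) (a : F) :
    listProd σ δ (List.replicate r a) = (X - C a) ^ r := by
  simp [listProd]

theorem linProd_const (r : ℕ) (a : F) : linProd σ δ (fun _ : Fin r => a) = (X - C a) ^ r := by
  induction r with
  | zero => rfl
  | succ r ih => rw [linProd, ih, pow_succ']

/-- Least common left multiple of two distinct linear factors. -/
theorem exists_conjugate_exchange {a b : F} (hab : a ≠ b) :
    ∃ a' b' : F, IsSkewConjugate σ δ a' a ∧ IsSkewConjugate σ δ b' b ∧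
      ((X - C a') * (X - C b) : SkewPoly σ δ) = (X - C b') * (X - C a) := by
  have hβ : a - b ≠ 0 := sub_ne_zero.2 hab
  obtain ⟨a', ha'⟩ : ∃ a', a' * (a - b) = σ (a - b) * a + δ (a - b) :=
    ⟨(σ (a - b) * a + δ (a - b)) * (a - b)⁻¹, inv_mul_cancel_right₀ hβ _⟩
  -- The second root is forced by comparing the coefficients of x in the two products; the same β =
  -- a - b realises both conjugacies.
  refine ⟨a', a' - σ (a - b), IsSkewConjugate.iff_exists_mul.2 ⟨_, hβ, ha'⟩,
    IsSkewConjugate.iff_exists_mul.2 ⟨_, hβ, ?_⟩, ?_⟩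
  · rw [sub_mul, ha', mul_sub]; abel
  · have h1 : ((X - C a') * C (a - b) : SkewPoly σ δ) = C (σ (a - b)) * (X - C a) := by
      rw [sub_mul, X_mul_C, ← C_mul, ha', C_add, C_mul, mul_sub]; abel
    have h2 : (X - C b : SkewPoly σ δ) = (X - C a) + C (a - b) := by
      rw [C_sub]; abel
    rw [h2, mul_add, h1, C_sub, ← add_mul]
    congr 1; abel

/-- The exchanged product is the least common left multiple of x - a and x - b. Divide f by x - a'
with remainder c: modulo left multiples of x - a, f (x - b) reduces to the constant c(a - b), which
must vanish. -/
theorem exists_eq_mul_of_common_left_multiple {a b a' b' : F} (hab : a ≠ b)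
    (h : ((X - C a') * (X - C b) : SkewPoly σ δ) = (X - C b') * (X - C a))
    {f g : SkewPoly σ δ} (hfg : g * (X - C a) = f * (X - C b)) :
    ∃ k : SkewPoly σ δ, g = k * (X - C b') ∧ f = k * (X - C a') := by
  obtain ⟨R, hR, k, hk⟩ := exists_remainder _ (X_sub_C_isMonicOfDegree a') f
  -- A remainder of degree < 1 is a constant.
  obtain ⟨c, rfl⟩ : ∃ c, R = C c := by
    refine ⟨R.coeff 0, SkewPoly.ext (Finsupp.ext fun i => ?_)⟩
    change R.coeff i = (C (R.coeff 0) : SkewPoly σ δ).coeff i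
    rw [coeff_C]
    split_ifs with hi
    · rw [hi]
    · exact (degree_lt_iff R 1).1 hR i (by omega)
  have h1 : (C (c * (a - b)) : SkewPoly σ δ) = (g - k * (X - C b') - C c) * (X - C a) := by
    rw [sub_mul, sub_mul, hfg, hk, add_mul, mul_assoc, h, mul_assoc, C_mul, C_sub]
    noncomm_ring
  have h2 := congrArg (coeff · 0) <| (X_sub_C_isMonicOfDegree a).eq_zero_of_degree_lt
    ((degree_lt_iff _ _).2 fun i hi => by rw [coeff_C, if_neg (by omega)]) h1
  have hc : c = 0 := by
    simpa [coeff_C, coeff_zero, sub_eq_zero, hab] using h2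
  subst hc
  rw [C_zero, add_zero] at hk
  refine ⟨k, mul_X_sub_C_cancel a ?_, hk⟩
  rw [hfg, hk, mul_assoc, h, mul_assoc]

/-- The factor x - a is moved leftwards through the product by successive exchanges. Each one
replaces a by a conjugate, so a has to be quantified inside the induction, and a ∉ L would not be
enough: non-conjugacy keeps every later exchange between distinct roots. -/
theorem exists_conjugate_list (L : List F) : ∀ (a : F)
    (_ : ∀ b ∈ L, ¬ IsSkewConjugate σ δ b a) (f g : SkewPoly σ δ)
    (_ : g * (X - C a) = f * listProd σ δ L),
    ∃ L' : List F, L'.length = L.length ∧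
      (∀ b' ∈ L', ∃ b ∈ L, IsSkewConjugate σ δ b' b) ∧ ∃ h, g = h * listProd σ δ L' := by
  induction L with
  | nil => exact fun _ _ _ g _ => ⟨[], rfl, by simp, g, by simp [listProd_nil]⟩
  | cons b L ih =>
    intro a hL f g hfg
    have hab : a ≠ b := by
      rintro rfl
      exact hL a List.mem_cons_self (.refl a)
    obtain ⟨a', b', ha', hb', hex⟩ := exists_conjugate_exchange (σ := σ) (δ := δ) hab
    rw [listProd_cons, ← mul_assoc] at hfg
    obtain ⟨k, hk, hk'⟩ := exists_eq_mul_of_common_left_multiple hab hex hfg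
    obtain ⟨L', hlen, hconj, h, hh⟩ := ih a'
      (fun c hc hca => hL c (List.mem_cons_of_mem _ hc) (hca.trans ha')) _ _ hk'.symm
    refine ⟨b' :: L', by simp [hlen], ?_, h, ?_⟩
    · intro c hc
      rcases List.mem_cons.1 hc with rfl | hc
      · exact ⟨b, List.mem_cons_self, hb'⟩
      · obtain ⟨d, hd, hcd⟩ := hconj c hc
        exact ⟨d, List.mem_cons_of_mem _ hd, hcd⟩
    · rw [hk, hh, listProd_cons, mul_assoc]

/-- Induction on the total number of linear factors. Arbitrary lists replace the powers (x -
aᵢ)^{rᵢ} because splitting off a factor leaves the other products with roots known only up to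
conjugacy. -/
theorem exists_list_of_common_left_multiple {ι : Type*} [Fintype ι] (m : ℕ) :
    ∀ (L : ι → List F) (_ : ∑ i, (L i).length = m)
      (_ : ∀ i j, i ≠ j → ∀ b ∈ L i, ∀ c ∈ L j, ¬ IsSkewConjugate σ δ b c)
      (f : SkewPoly σ δ) (_ : ∀ i, ∃ g, f = g * listProd σ δ (L i)),
      ∃ M : List F, M.length = m ∧ ∃ g, f = g * listProd σ δ M := by
  classical
  induction m with
  | zero => exact fun _ _ _ f _ => ⟨[], rfl, f, by simp [listProd_nil]⟩
  | succ m ih =>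
    intro L hm hL f hf
    obtain ⟨i, hi⟩ : ∃ i, L i ≠ [] := by
      by_contra! h
      simp [h] at hm
    obtain ⟨b, t, hbt⟩ := List.exists_cons_of_ne_nil hi
    obtain ⟨u, hu⟩ := hf i
    rw [hbt, listProd_cons, ← mul_assoc] at hu
    -- The quotient of f by x - b keeps the tail of the i-th list as it is, and each other list up
    -- to conjugation. Only the i-th list gets shorter, by one.
    have hother : ∀ j, ∃ L' : List F, (L'.length = if j = i then t.length else (L j).length) ∧
        (∀ b' ∈ L', ∃ b ∈ L j, IsSkewConjugate σ δ b' b) ∧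
        ∃ h, u * listProd σ δ t = h * listProd σ δ L' := by
      intro j
      by_cases hj : j = i
      · subst hj
        exact ⟨t, by simp, fun c hc => ⟨c, by simp [hbt, hc], .refl c⟩, u, rfl⟩
      · obtain ⟨v, hv⟩ := hf j
        rw [if_neg hj]
        exact exists_conjugate_list (L j) b (fun c hc => hL j i hj c hc b (by simp [hbt])) _ _
          (hu.symm.trans hv)
    choose L' hlen hconj hdiv using hother
    obtain ⟨M, hM, g, hg⟩ := ih L' (by
        have h1 : ∀ j, (L j).length = (L' j).length + if j = i then 1 else 0 := by
          intro j
          rw [hlen]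
          split_ifs with hj
          · simp [hj, hbt]
          · rfl
        simp only [h1, Finset.sum_add_distrib, Finset.sum_ite_eq', Finset.mem_univ, if_true] at hm
        omega)
      (by
        intro j k hjk b hb c hc hbc
        obtain ⟨b', hb', hbb⟩ := hconj j b hb
        obtain ⟨c', hc', hcc⟩ := hconj k c hc
        exact hL j k hjk b' hb' c' hc' ((hbb.symm.trans hbc).trans hcc))
      _ hdiv
    exact ⟨b :: M, by simp [hM], g, by rw [hu, hg, listProd_cons, mul_assoc]⟩

/-! ### Left linearity of Hasse derivatives, and divisibility from their vanishing. -/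

theorem remainder_unique {r : ℕ} (a : Fin r → F) {f R : SkewPoly σ δ}
    (hR : R.degree < (r : WithBot ℕ)) (h : ∃ G, f = G * linProd σ δ a + R) :
    remainder a f = R :=
  (existsUnique_remainder _ (linProd_isMonicOfDegree a) f).unique (remainder_spec a f) ⟨hR, h⟩

theorem remainder_add {r : ℕ} (a : Fin r → F) (f g : SkewPoly σ δ) :
    remainder a (f + g) = remainder a f + remainder a g := by
  obtain ⟨hf, G, hG⟩ := remainder_spec a f
  obtain ⟨hg, H, hH⟩ := remainder_spec a g
  refine remainder_unique a (degree_add_lt hf hg) ⟨G + H, ?_⟩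
  conv_lhs => rw [hG, hH]
  rw [add_mul]; abel

theorem remainder_C_mul {r : ℕ} (a : Fin r → F) (c : F) (f : SkewPoly σ δ) :
    remainder a (C c * f) = C c * remainder a f := by
  obtain ⟨hf, G, hG⟩ := remainder_spec a f
  refine remainder_unique a (degree_C_mul_lt c hf) ⟨C c * G, ?_⟩
  conv_lhs => rw [hG]
  rw [mul_add, mul_assoc]

/-- The Hasse derivative as an additive map. -/
noncomputable def hasseDerivHom {r : ℕ} (a : Fin (r + 1) → F) : SkewPoly σ δ →+ F :=
  AddMonoidHom.mk' (hasseDeriv a) fun f g => by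
    rw [hasseDeriv, remainder_add, coeff_add]; rfl

theorem hasseDerivHom_apply {r : ℕ} (a : Fin (r + 1) → F) (f : SkewPoly σ δ) :
    hasseDerivHom a f = hasseDeriv a f := rfl

theorem hasseDeriv_C_mul {r : ℕ} (a : Fin (r + 1) → F) (c : F) (f : SkewPoly σ δ) :
    hasseDeriv a (C c * f) = c * hasseDeriv a f := by
  rw [hasseDeriv, remainder_C_mul, coeff_C_mul]; rfl

/-- Inductively f is a left multiple of (x - a)^r, hence so is its remainder R modulo (x - a)^{r+1}.
The coefficient of x^r in R is f^{(r)}(a) = 0, so deg R < r and R = 0. -/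
theorem exists_eq_mul_X_sub_C_pow (a : F) (r : ℕ) (f : SkewPoly σ δ)
    (h : ∀ j < r, f.hasseDerivAt j a = 0) : ∃ g : SkewPoly σ δ, f = g * (X - C a) ^ r := by
  induction r with
  | zero => exact ⟨f, by simp⟩
  | succ r ih =>
    obtain ⟨g, hg⟩ := ih fun j hj => h j (by omega)
    obtain ⟨hR, G, hG⟩ := remainder_spec (fun _ : Fin (r + 1) => a) f
    set R := remainder (fun _ : Fin (r + 1) => a) f
    have hlt : R.degree < (r : WithBot ℕ) := by
      rw [degree_lt_iff] at hR ⊢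
      intro i hi
      rcases hi.eq_or_lt with rfl | hi
      · exact h r (by omega)
      · exact hR i hi
    rw [linProd_const] at hG
    have h0 : R = 0 := (linProd_isMonicOfDegree (fun _ : Fin r => a)).eq_zero_of_degree_lt hlt
      (g := g - G * (X - C a)) (by
        rw [linProd_const, sub_mul, ← hg, mul_assoc, ← pow_succ', eq_sub_iff_add_eq, add_comm,
          ← hG])
    exact ⟨G, by rw [hG, h0, add_zero]⟩

theorem eq_zero_of_hasseDerivAt_eq_zero {n : ℕ} {a : Fin n → F}
    (ha : Pairwise fun i j => ¬ IsSkewConjugate σ δ (a i) (a j)) (r : Fin n → ℕ)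
    {f : SkewPoly σ δ} (hf : f.degree < ((∑ i, r i : ℕ) : WithBot ℕ))
    (h : ∀ (i : Fin n) (j : Fin (r i)), f.hasseDerivAt (j : ℕ) (a i) = 0) : f = 0 := by
  obtain ⟨M, hM, g, hg⟩ := exists_list_of_common_left_multiple (σ := σ) (δ := δ) (∑ i, r i)
    (fun i => List.replicate (r i) (a i)) (by simp)
    (by
      intro i j hij b hb c hc
      rw [List.eq_of_mem_replicate hb, List.eq_of_mem_replicate hc]
      exact ha hij)
    f (fun i => by
      rw [listProd_replicate]
      exact exists_eq_mul_X_sub_C_pow _ _ _ fun j hj => h i ⟨j, hj⟩)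
  exact (listProd_isMonicOfDegree M).eq_zero_of_degree_lt (by rwa [hM]) hg

/-! ### The confluent Vandermonde matrix as the matrix of the evaluation map. -/

/-- The skew polynomial `∑ vₖ xᵏ` with coefficient vector `v`. -/
noncomputable def ofVector (σ : F →+* F) (δ : SkewDerivation σ) {N : ℕ} (v : Fin N → F) :
    SkewPoly σ δ :=
  ∑ k, C (v k) * X ^ (k : ℕ)

theorem coeff_ofVector {N : ℕ} (v : Fin N → F) (k : Fin N) :
    (ofVector σ δ v).coeff k = v k := by
  simp [ofVector, coeff_sum, coeff_C_mul_X_pow, Fin.val_inj]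

theorem degree_ofVector_lt {N : ℕ} (v : Fin N → F) :
    (ofVector σ δ v).degree < (N : WithBot ℕ) := by
  rw [degree_lt_iff]
  intro i hi
  rw [ofVector, coeff_sum]
  refine Finset.sum_eq_zero fun k _ => ?_
  rw [coeff_C_mul_X_pow, if_neg (by omega)]

theorem confluentVandermonde_apply {N n : ℕ} (r : Fin n → ℕ) (a : Fin n → F) (k : Fin N)
    (i : Fin n) (j : Fin (r i)) :
    confluentVandermonde σ δ N r (fun i _ => a i) k (finSigmaFinEquiv ⟨i, j⟩) =
      (X ^ (k : ℕ) : SkewPoly σ δ).hasseDerivAt (j : ℕ) (a i) := by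
  change (X ^ (k : ℕ) : SkewPoly σ δ).hasseDerivAt
    ((finSigmaFinEquiv.symm (finSigmaFinEquiv ⟨i, j⟩)).2 : ℕ)
    (a (finSigmaFinEquiv.symm (finSigmaFinEquiv ⟨i, j⟩)).1) = _
  rw [Equiv.symm_apply_apply]

/-- Coefficients stand on the left and Hasse derivatives are left linear, so the matrix acts on row
vectors. -/
theorem vecMul_confluentVandermonde {N n : ℕ} (r : Fin n → ℕ) (a : Fin n → F) (v : Fin N → F)
    (i : Fin n) (j : Fin (r i)) :
    (Matrix.vecMul v (confluentVandermonde σ δ N r fun i _ => a i)) (finSigmaFinEquiv ⟨i, j⟩) =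
      (ofVector σ δ v).hasseDerivAt (j : ℕ) (a i) := by
  rw [hasseDerivAt, ← hasseDerivHom_apply, ofVector, map_sum]
  simp only [hasseDerivHom_apply, hasseDeriv_C_mul]
  rw [Matrix.vecMul, dotProduct]
  refine Finset.sum_congr rfl fun k _ => congrArg (v k * ·) ?_
  exact confluentVandermonde_apply r a k i j

theorem vecMul_confluentVandermonde_bijective {n : ℕ} {a : Fin n → F}
    (ha : Pairwise fun i j => ¬ IsSkewConjugate σ δ (a i) (a j)) (r : Fin n → ℕ) :
    Function.Bijective fun v =>
      Matrix.vecMul v (confluentVandermonde σ δ (∑ i, r i) r fun i _ => a i) := by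
  let V := confluentVandermonde σ δ (∑ i, r i) r fun i _ => a i
  have hinj : Function.Injective (Matrix.vecMulLinear V) := by
    rw [← LinearMap.ker_eq_bot, LinearMap.ker_eq_bot']
    intro v hv
    have h0 : ofVector σ δ v = 0 := by
      refine eq_zero_of_hasseDerivAt_eq_zero ha r (degree_ofVector_lt v) fun i j => ?_
      rw [← vecMul_confluentVandermonde]
      exact congrFun hv _
    ext k
    rw [← coeff_ofVector (σ := σ) (δ := δ) v k, h0]
    rfl
  -- The matrix is square: an injective endomorphism of a finite-dimensional left vector space is
  -- surjective.
  exact ⟨hinj, LinearMap.injective_iff_surjective.1 hinj⟩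

end SkewPoly

/-- Determinants are unavailable over a noncommutative ring. Surjectivity gives the rows of a left
inverse B; then (VB)V = V = 1·V, and injectivity, applied row by row, gives VB = 1. -/
theorem Matrix.isUnit_of_vecMul_bijective {F ι : Type*} [Ring F] [Fintype ι] [DecidableEq ι]
    {V : Matrix ι ι F} (hV : Function.Bijective fun v => Matrix.vecMul v V) : IsUnit V := by
  choose B hB using fun i : ι => hV.2 (Pi.single i 1)
  have hBV : Matrix.of B * V = 1 := by
    ext i j
    rw [Matrix.mul_apply_eq_vecMul]
    exact (congrFun (hB i) j).trans (by simp [Matrix.one_apply, Pi.single_apply, eq_comm])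
  have hVB : V * Matrix.of B = 1 := by
    refine funext fun i => hV.1 ?_
    change Matrix.vecMul ((V * Matrix.of B) i) V = Matrix.vecMul ((1 : Matrix ι ι F) i) V
    rw [← Matrix.mul_apply_eq_vecMul, ← Matrix.mul_apply_eq_vecMul, Matrix.mul_assoc, hBV]
    simp
  exact ⟨⟨V, Matrix.of B, hVB, hBV⟩, rfl⟩

theorem mainTheorem9 {F : Type*} [DivisionRing F] (σ : F →+* F) (δ : SkewDerivation σ)
    (n : ℕ) (a : Fin n → F)
    (ha : Pairwise fun i j => ¬ IsSkewConjugate σ δ (a i) (a j))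
    (r : Fin n → ℕ) (hr : ∀ i, 0 < r i) :
    (∀ b : (i : Fin n) → Fin (r i) → F,
      ∃! f : SkewPoly σ δ, f.degree < ((∑ i, r i : ℕ) : WithBot ℕ) ∧
        ∀ (i : Fin n) (j : Fin (r i)), f.hasseDerivAt (j : ℕ) (a i) = b i j) ∧
    IsUnit (confluentVandermonde σ δ (∑ i, r i) r fun i _ => a i) := by
  have hV := SkewPoly.vecMul_confluentVandermonde_bijective ha r
  refine ⟨fun b => ?_, Matrix.isUnit_of_vecMul_bijective hV⟩
  obtain ⟨v, hv⟩ := hV.2 fun c => b (finSigmaFinEquiv.symm c).1 (finSigmaFinEquiv.symm c).2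
  refine ⟨SkewPoly.ofVector σ δ v, ⟨SkewPoly.degree_ofVector_lt v, fun i j => ?_⟩, ?_⟩
  · rw [← SkewPoly.vecMul_confluentVandermonde]
    refine (congrFun hv _).trans ?_
    rw [Equiv.symm_apply_apply]
  · rintro g ⟨hg, hgb⟩
    rw [← sub_eq_zero]
    refine SkewPoly.eq_zero_of_hasseDerivAt_eq_zero ha r
      (SkewPoly.degree_sub_lt hg (SkewPoly.degree_ofVector_lt v)) fun i j => ?_
    rw [SkewPoly.hasseDerivAt, ← SkewPoly.hasseDerivHom_apply, map_sub, sub_eq_zero]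
    refine (hgb i j).trans ?_
    change _ = (SkewPoly.ofVector σ δ v).hasseDerivAt (j : ℕ) (a i)
    rw [← SkewPoly.vecMul_confluentVandermonde]
    refine Eq.trans ?_ (congrFun hv _).symm
    rw [Equiv.symm_apply_apply]
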